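/- **Theorem 4.3 (Conservation of the total mass).** Let $\varepsilon>0$, $\sigma>0$, $\alpha,\gamma,\chi\in\mathbb R$, let $y\in\mathbb R^2$, and let $\mathbf C:\mathbb R^2\to\mathbb R^2$ be a bounded, uniformly continuous $C^1$ map whose first partial derivatives are bounded and uniformly continuous. Put $g(x)=\frac1{2\pi\sigma^2}e^{-|x|^2/(2\sigma^2)}$. On $L^1(\mathbb R^2)$ let $A$ (the realization of $\varepsilon^2\Delta$) be the infinitesimal generator of the heat semigroup $$v\mapsto\int_{\mathbb R^2}\frac{1}{4\pi\varepsilon^2t}e^{-|x-z|^2/(4\varepsilon^2t)}v(z)\,dz ,$$ and let $B$ (the realization of $v\mapsto-\nabla\cdot(v\,\mathbf C)$) be the infinitesimal generator of the semigroup $$v\mapsto \exp\Big(-\int_0^t(\nabla\cdot\mathbf C)(\Pi(-s)x)\,ds\Big)\,v(\Pi(-t)x),$$ where $\Pi$ is the flow of $\dot z=\mathbf C(z)$. Let $u_0\in\mathbb R$, $v_0,w_0\in L^1(\mathbb R^2)$, and let $(u,v,w)$ be the mild solution of $$u'=\chi\int_{\mathbb R^2}w\,dx-\gamma u,\qquad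 v'=(A+B)v-\alpha v+\gamma\,g(\cdot-y)\,u,\qquad w'=\alpha v-\chi w,$$ with initial value $(u_0,v_0,w_0)$; that is, $(u,v,w):[0,\infty)\to\mathbb R\times L^1(\mathbb R^2)\times L^1(\mathbb R^2)$ is continuous and, for every $t\ge0$, $\int_0^tv(s)\,ds\in D(A)\cap D(B)$ and $$\begin{aligned}u(t)&=u_0+\chi\int_{\mathbb R^2}\Big(\int_0^tw(s)\,ds\Big)dx-\gamma\int_0^tu(s)\,ds,\\ v(t)&=v_0+(A+B)\int_0^tv(s)\,ds-\alpha\int_0^tv(s)\,ds+\gamma\,g(\cdot-y)\int_0^tu(s)\,ds,\\ w(t)&=w_0+\alpha\int_0^tv(s)\,ds-\chi\int_0^tw(s)\,ds.\end{aligned}$$ Define $V(t)=\int_{\mathbb R^2}v(t,x)\,dx$ and $W(t)=\int_{\mathbb R^2}w(t,x)\,dx$. Then $u$, $V$, $W$ are differentiable on $[0,\infty)$ (one-sidedly at $t=0$) and satisfy, for all $t\ge0$, $$u'(t)=\chi W(t)-\gamma u(t),\qquad V'(t)=-\alpha V(t)+\gamma u(t),\qquad W'(t)=\alpha V(t)-\chi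 W(t),$$ with $u(0)=u_0$, $V(0)=\int_{\mathbb R^2}v_0\,dx$, $W(0)=\int_{\mathbb R^2}w_0\,dx$. Moreover the number of individuals having their home at $y$ is constant in time: with $n(y)=u_0+\int_{\mathbb R^2}v_0\,dx+\int_{\mathbb R^2}w_0\,dx$, $$u(t)+\int_{\mathbb R^2}v(t,x)\,dx+\int_{\mathbb R^2}w(t,x)\,dx=n(y)\qquad\text{for all }t\ge0 .$$ -/

import Mathlib

open MeasureTheory Filter Topology Set

namespace ReturnHome

noncomputable section

/-- The plane with its Euclidean norm. -/
abbrev Plane : Type := EuclideanSpace ℝ (Fin 2)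

/-- The Banach space of (classes of) Lebesgue integrable real functions on the plane. -/
abbrev L1 : Type := Lp ℝ 1 (volume : Measure Plane)

/-- The total mass of an integrable function. -/
def mass (φ : L1) : ℝ := ∫ x, φ x

/-- The partial derivative in the direction of the `i`-th coordinate of a vector field. -/
def partialDeriv (C : Plane → Plane) (i : Fin 2) (x : Plane) : Plane :=
  fderiv ℝ C x (EuclideanSpace.single i 1)

/-- The divergence of a vector field. -/
def divergence (C : Plane → Plane) (x : Plane) : ℝ :=
  ∑ i : Fin 2, (partialDeriv C i x) i

/-- The regularity that is required of the speed of travelers: bounded, uniformly continuous,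
of class `C¹`, with bounded and uniformly continuous first partial derivatives. -/
structure IsAdmissibleSpeed (C : Plane → Plane) : Prop where
  bounded : ∃ M : ℝ, ∀ x, ‖C x‖ ≤ M
  uniformContinuous : UniformContinuous C
  contDiff : ContDiff ℝ 1 C
  partial_bounded : ∀ i, ∃ M : ℝ, ∀ x, ‖partialDeriv C i x‖ ≤ M
  partial_uniformContinuous : ∀ i, UniformContinuous (partialDeriv C i)

/-- `flow` is the global flow of the autonomous differential equation `z' = C z`. It exists and is
unique for an admissible speed. -/
def IsFlow (C : Plane → Plane) (flow : ℝ → Plane → Plane) : Prop :=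
  (∀ z, flow 0 z = z) ∧ ∀ t z, HasDerivAt (fun s => flow s z) (C (flow t z)) t

/-- The heat kernel `K(t, x)` of `ε² Δ` on the plane. -/
def heatKernel (ε t : ℝ) (x : Plane) : ℝ :=
  1 / (4 * Real.pi * ε ^ 2 * t) * Real.exp (-‖x‖ ^ 2 / (4 * ε ^ 2 * t))

/-- The diffusion semigroup on integrable functions. -/
def heatSemigroup (ε t : ℝ) (φ : Plane → ℝ) (x : Plane) : ℝ :=
  if t = 0 then φ x else ∫ z, heatKernel ε t (x - z) * φ z

/-- The convection semigroup on integrable functions (integration along the characteristics of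
the flow of `C`). -/
def convectionSemigroup (C : Plane → Plane) (flow : ℝ → Plane → Plane) (t : ℝ)
    (φ : Plane → ℝ) (x : Plane) : ℝ :=
  Real.exp (-∫ s in (0 : ℝ)..t, divergence C (flow (-s) x)) * φ (flow (-t) x)

/-- `φ` lies in the domain of the infinitesimal generator of the semigroup `S` on `L¹`, and the
generator maps it to `f`: the quotients `(S t φ - φ) / t` converge to `f` in `L¹` as `t ↓ 0`. -/
def GeneratorMapsTo (S : ℝ → (Plane → ℝ) → Plane → ℝ) (φ f : L1) : Prop :=
  Tendsto (fun t : ℝ => eLpNorm (fun x => t⁻¹ * (S t φ x - φ x) - f x) 1 volume)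
    (𝓝[>] 0) (𝓝 0)

/-- `φ ∈ D(A)` and `A φ = f`, where `A` is the realization of `ε² Δ` in `L¹`, that is, the
generator of the diffusion semigroup. -/
def DiffusionMapsTo (ε : ℝ) (φ f : L1) : Prop :=
  GeneratorMapsTo (heatSemigroup ε) φ f

/-- `φ ∈ D(B)` and `B φ = f`, where `B` is the realization of `φ ↦ -∇ · (φ C)` in `L¹`, that is,
the generator of the convection semigroup. -/
def ConvectionMapsTo (C : Plane → Plane) (φ f : L1) : Prop :=
  ∃ flow, IsFlow C flow ∧ GeneratorMapsTo (convectionSemigroup C flow) φ f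

/-- The centered Gaussian density with standard deviation `σ` on the plane. -/
def gaussian (σ : ℝ) (x : Plane) : ℝ :=
  1 / (2 * Real.pi * σ ^ 2) * Real.exp (-(x 0 ^ 2 + x 1 ^ 2) / (2 * σ ^ 2))

/-- `(u, v, w)` is the mild solution with initial value `(u₀, v₀, w₀)` of the return-home system
for homes located at `y`,
`u' = χ ∫ w - γ u`,
`v' = ε² Δ v - ∇ · (v C) - α v + γ g(· - y) u`,
`w' = α v - χ w`.
That is, `(u, v, w)` is continuous from `[0, ∞)` to `ℝ × L¹ × L¹` and, for every `t ≥ 0`, its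
integral over `[0, t]` lies in the domain `ℝ × D(A) × L¹` of the operator on the right-hand side,
which maps it to `(u t, v t, w t) - (u₀, v₀, w₀)`. -/
structure IsMildSolution (ε σ α γ χ : ℝ) (C : Plane → Plane) (y : Plane)
    (u₀ : ℝ) (v₀ w₀ : L1) (u : ℝ → ℝ) (v w : ℝ → L1) : Prop where
  continuous_u : ContinuousOn u (Ici 0)
  continuous_v : ContinuousOn v (Ici 0)
  continuous_w : ContinuousOn w (Ici 0)
  home : ∀ t, 0 ≤ t →
    u t = u₀ + χ * mass (∫ s in (0 : ℝ)..t, w s) - γ * ∫ s in (0 : ℝ)..t, u s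
  travel : ∀ t, 0 ≤ t → ∃ a b : L1,
    DiffusionMapsTo ε (∫ s in (0 : ℝ)..t, v s) a ∧
    ConvectionMapsTo C (∫ s in (0 : ℝ)..t, v s) b ∧
    ∀ᵐ x : Plane, v t x = v₀ x + (a x + b x) - α * (∫ s in (0 : ℝ)..t, v s : L1) x
      + γ * gaussian σ (x - y) * ∫ s in (0 : ℝ)..t, u s
  work : ∀ t, 0 ≤ t →
    w t = w₀ + α • (∫ s in (0 : ℝ)..t, v s) - χ • ∫ s in (0 : ℝ)..t, w s

end

end ReturnHome

/-! Integrating the mild equations over the plane gives a closed linear system for `u` and the two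
masses, provided the diffusion and convection terms contribute nothing. Granted this, the
fundamental theorem of calculus yields the differential equations, and adding the integrated
equations makes every exchange term cancel.

A generator value is the `L¹` limit of difference quotients. If the semigroup preserves mass for
small positive times, these quotients have integral zero, and hence so does the limit
(`mass_eq_zero_of_generatorMapsTo`). The heat semigroup preserves mass because it is convolution
with a kernel of integral one. The convection semigroup does so by change of variables: its weight
is the Jacobian determinant of the backward flow.

The latter takes most of the work: differentiability of the flow in its initial value, by Gronwall
applied to the variational equation (`hasFDerivAt_flow`), and Liouville's formula
(`det_eq_exp_integral_trace`). Since only small times matter, a single Picard–Lindelöf step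
suffices. -/

namespace ReturnHome

/-! ### Variational equation and differentiability of flows -/

/-- A linear differential equation with a bounded continuous coefficient has an operator valued
fundamental solution on a short time interval. -/
theorem exists_fundamentalSolution {E : Type*} [NormedAddCommGroup E] [NormedSpace ℝ E]
    [CompleteSpace E] {A : ℝ → E →L[ℝ] E} (hA : Continuous A) {K : NNReal} (hK : ∀ t, ‖A t‖ ≤ K)
    {τ : ℝ} (hτ : 0 ≤ τ) (hKτ : K * τ ≤ 1 / 2) :
    ∃ M : ℝ → E →L[ℝ] E, M 0 = ContinuousLinearMap.id ℝ E ∧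
      ∀ t ∈ Icc 0 τ, HasDerivWithinAt M ((A t).comp (M t)) (Icc 0 τ) t := by
  -- On the unit ball about the identity `‖X‖ ≤ 2`, so the speed is at most `2K`; `2Kτ ≤ 1` keeps
  -- the solution in the ball.
  have h : IsPicardLindelof (fun t (X : E →L[ℝ] E) => (A t).comp X)
      (⟨0, left_mem_Icc.2 hτ⟩ : Icc (0 : ℝ) τ) (ContinuousLinearMap.id ℝ E) 1 0 (2 * K) K := by
    refine ⟨fun t _ => ?_, fun X _ => ?_, fun t _ X hX => ?_, ?_⟩
    · refine LipschitzOnWith.of_dist_le_mul fun X _ Y _ => ?_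
      rw [dist_eq_norm, dist_eq_norm, ← ContinuousLinearMap.comp_sub]
      exact (ContinuousLinearMap.opNorm_comp_le _ _).trans
        (mul_le_mul_of_nonneg_right (hK t) (norm_nonneg _))
    · exact (hA.clm_comp continuous_const).continuousOn
    · have hX' : ‖X‖ ≤ 2 := by
        have h1 : ‖X - ContinuousLinearMap.id ℝ E‖ ≤ 1 := by
          simpa [dist_eq_norm] using hX
        have h2 : ‖ContinuousLinearMap.id ℝ E‖ ≤ 1 := ContinuousLinearMap.norm_id_le
        have h3 := norm_add_le (X - ContinuousLinearMap.id ℝ E) (ContinuousLinearMap.id ℝ E)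
        rw [sub_add_cancel] at h3
        linarith
      calc ‖(A t).comp X‖ ≤ ‖A t‖ * ‖X‖ := ContinuousLinearMap.opNorm_comp_le _ _
        _ ≤ K * 2 := mul_le_mul (hK t) hX' (norm_nonneg _) K.2
        _ = ((2 * K : NNReal) : ℝ) := by push_cast; ring
    · simp only [sub_zero, sub_self, NNReal.coe_mul, NNReal.coe_one, NNReal.coe_zero,
        NNReal.coe_ofNat, max_eq_left hτ]
      linarith
  obtain ⟨M, h0, hM⟩ := h.exists_eq_forall_mem_Icc_hasDerivWithinAt₀
  exact ⟨M, h0, hM⟩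

/-- A function with uniformly continuous derivative is, at all pairs of nearby points, uniformly
well approximated by its linearization. -/
theorem exists_norm_sub_sub_fderiv_le {E F : Type*} [NormedAddCommGroup E] [NormedSpace ℝ E]
    [NormedAddCommGroup F] [NormedSpace ℝ F]
    {f : E → F} (hf : Differentiable ℝ f) (hf' : UniformContinuous (fderiv ℝ f))
    {η : ℝ} (hη : 0 < η) :
    ∃ δ > 0, ∀ a b, ‖b - a‖ < δ → ‖f b - f a - fderiv ℝ f a (b - a)‖ ≤ η * ‖b - a‖ := by
  obtain ⟨δ, hδ, h⟩ := Metric.uniformContinuous_iff.1 hf' η hη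
  refine ⟨δ, hδ, fun a b hab => ?_⟩
  refine (convex_ball a δ).norm_image_sub_le_of_norm_fderiv_le' (fun x _ => hf x)
    (fun x hx => ?_) (Metric.mem_ball_self hδ) (by simpa [dist_eq_norm] using hab)
  rw [← dist_eq_norm]
  exact (h (Metric.mem_ball.1 hx)).le

section Flow

variable {E : Type*} [NormedAddCommGroup E] [NormedSpace ℝ E] {f : E → E} {Φ : ℝ → E → E}
  {K : NNReal}

theorem dist_flow_le (hf : LipschitzWith K f) (h0 : ∀ z, Φ 0 z = z)
    (hΦ : ∀ t z, HasDerivAt (fun s => Φ s z) (f (Φ t z)) t) {t : ℝ} (ht : 0 ≤ t) (a b : E) :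
    dist (Φ t a) (Φ t b) ≤ dist a b * Real.exp (K * t) := by
  have h := dist_le_of_trajectories_ODE (v := fun _ => f) (f := fun s => Φ s a)
    (g := fun s => Φ s b) (a := 0) (b := t) (δ := dist a b) (fun _ => hf)
    (fun s _ => (hΦ s a).continuousAt.continuousWithinAt)
    (fun s _ => (hΦ s a).hasDerivWithinAt)
    (fun s _ => (hΦ s b).continuousAt.continuousWithinAt)
    (fun s _ => (hΦ s b).hasDerivWithinAt) (by simp [h0]) t (right_mem_Icc.2 ht)
  simpa using h

theorem flow_comp_flow (hf : LipschitzWith K f) (h0 : ∀ z, Φ 0 z = z)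
    (hΦ : ∀ t z, HasDerivAt (fun s => Φ s z) (f (Φ t z)) t) (s t : ℝ) (z : E) :
    Φ s (Φ t z) = Φ (s + t) z := by
  have h : (fun r => Φ r (Φ t z)) = fun r => Φ (r + t) z := by
    refine ODE_solution_unique_univ (v := fun _ => f) (s := fun _ => univ) (t₀ := 0) (K := K)
      (fun _ => hf.lipschitzOnWith) (fun r => ⟨hΦ r _, mem_univ _⟩)
      (fun r => ⟨?_, mem_univ _⟩) (by simp [h0])
    exact (hΦ (r + t) z).comp_add_const r t
  exact congrFun h s

theorem flow_bijective (hf : LipschitzWith K f) (h0 : ∀ z, Φ 0 z = z)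
    (hΦ : ∀ t z, HasDerivAt (fun s => Φ s z) (f (Φ t z)) t) (t : ℝ) :
    Function.Bijective (Φ t) := by
  refine Function.bijective_iff_has_inverse.2 ⟨Φ (-t), fun z => ?_, fun z => ?_⟩ <;>
  rw [flow_comp_flow hf h0 hΦ] <;> simp [h0]

/-- The flow of a vector field with bounded uniformly continuous derivative is differentiable in
the initial value, and its derivative is the solution of the variational equation. -/
theorem hasFDerivAt_flow (hf : Differentiable ℝ f) (hK : ∀ x, ‖fderiv ℝ f x‖ ≤ K)
    (hf' : UniformContinuous (fderiv ℝ f)) (h0 : ∀ z, Φ 0 z = z)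
    (hΦ : ∀ t z, HasDerivAt (fun s => Φ s z) (f (Φ t z)) t) (z : E) {τ : ℝ} (hτ : 0 ≤ τ)
    {M : ℝ → E →L[ℝ] E} (hM0 : M 0 = ContinuousLinearMap.id ℝ E)
    (hM : ∀ t ∈ Icc 0 τ, HasDerivWithinAt M ((fderiv ℝ f (Φ t z)).comp (M t)) (Icc 0 τ) t) :
    HasFDerivAt (Φ τ) (M τ) z := by
  have hlip : LipschitzWith K f :=
    lipschitzWith_of_nnnorm_fderiv_le hf fun x => by exact_mod_cast hK x
  rw [hasFDerivAt_iff_isLittleO, Asymptotics.isLittleO_iff]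
  intro c hc
  set L : ℝ := Real.exp (K * τ) with hL
  have hLpos : 0 < L := Real.exp_pos _
  -- With zero initial error the Gronwall bound tends to `0` with the forcing `q`.
  obtain ⟨q, hq, hqc⟩ : ∃ q > 0, gronwallBound 0 K q τ ≤ c := by
    have hlim : Tendsto (fun q => gronwallBound 0 K q τ) (𝓝[>] 0) (𝓝 0) := by
      have := (gronwallBound_continuous_ε 0 K τ).tendsto 0
      rw [gronwallBound_ε0_δ0] at this
      exact this.mono_left nhdsWithin_le_nhds
    obtain ⟨q, h1, h2⟩ := ((hlim.eventually (gt_mem_nhds hc)).and self_mem_nhdsWithin).exists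
    exact ⟨q, h2, h1.le⟩
  have hη : 0 < q / L := div_pos hq hLpos
  obtain ⟨δ, hδ, hδ'⟩ := exists_norm_sub_sub_fderiv_le hf hf' hη
  have hev : ∀ᶠ x in 𝓝 z, ‖x - z‖ < δ / L := by
    have : Tendsto (fun x => ‖x - z‖) (𝓝 z) (𝓝 0) := tendsto_norm_sub_self z
    exact this.eventually (gt_mem_nhds (div_pos hδ hLpos))
  filter_upwards [hev] with x hx
  have hdist : ∀ t ∈ Ico 0 τ, ‖Φ t x - Φ t z‖ ≤ ‖x - z‖ * L := by
    intro t ht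
    have := dist_flow_le hlip h0 hΦ ht.1 x z
    rw [dist_eq_norm, dist_eq_norm] at this
    refine this.trans (mul_le_mul_of_nonneg_left (Real.exp_le_exp.2 ?_) (norm_nonneg _))
    exact mul_le_mul_of_nonneg_left ht.2.le K.2
  have hMx : ∀ t ∈ Icc 0 τ, HasDerivWithinAt (fun t => M t (x - z))
      (fderiv ℝ f (Φ t z) (M t (x - z))) (Icc 0 τ) t := fun t ht => by
    simpa using (hM t ht).clm_apply (hasDerivWithinAt_const t (Icc 0 τ) (x - z))
  -- Gronwall for the first-order remainder: its derivative is at most `K` times the remainder plus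
  -- a linearization error, which the choice `η = q / L` bounds by `q * ‖x - z‖`.
  have hr := norm_le_gronwallBound_of_norm_deriv_right_le
    (f := fun t => Φ t x - Φ t z - M t (x - z))
    (f' := fun t => f (Φ t x) - f (Φ t z) - fderiv ℝ f (Φ t z) (M t (x - z)))
    (δ := 0) (K := K) (ε := q * ‖x - z‖) (a := 0) (b := τ)
    (fun t ht => ((hΦ t x).continuousAt.continuousWithinAt.sub
      (hΦ t z).continuousAt.continuousWithinAt).sub (hMx t ht).continuousWithinAt)
    (fun t ht => ?_) (by simp [h0, hM0]) (fun t ht => ?_) τ (right_mem_Icc.2 hτ)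
  · rw [sub_zero] at hr
    refine hr.trans ?_
    have : gronwallBound 0 K (q * ‖x - z‖) τ = gronwallBound 0 K q τ * ‖x - z‖ := by
      by_cases hK0 : (K : ℝ) = 0
      · simp only [hK0, gronwallBound_K0]; ring
      · simp only [gronwallBound_of_K_ne_0 hK0]; ring
    rw [this]
    exact mul_le_mul_of_nonneg_right hqc (norm_nonneg _)
  · refine ((hΦ t x).hasDerivWithinAt.sub (hΦ t z).hasDerivWithinAt).sub ?_
    exact ((hMx t (Ico_subset_Icc_self ht)).mono_of_mem_nhdsWithin
      (Icc_mem_nhdsGE_of_mem ht))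
  · have hsmall : ‖Φ t x - Φ t z‖ < δ :=
      (hdist t ht).trans_lt ((lt_div_iff₀ hLpos).1 hx)
    have h1 := hδ' (Φ t z) (Φ t x) hsmall
    have h2 : f (Φ t x) - f (Φ t z) - fderiv ℝ f (Φ t z) (M t (x - z)) =
        (f (Φ t x) - f (Φ t z) - fderiv ℝ f (Φ t z) (Φ t x - Φ t z)) +
          fderiv ℝ f (Φ t z) (Φ t x - Φ t z - M t (x - z)) := by
      rw [map_sub (fderiv ℝ f (Φ t z)) (Φ t x - Φ t z)]; abel
    have h3 : ‖fderiv ℝ f (Φ t z) (Φ t x - Φ t z - M t (x - z))‖ ≤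
        K * ‖Φ t x - Φ t z - M t (x - z)‖ :=
      (fderiv ℝ f (Φ t z)).le_of_opNorm_le (hK _) _
    have h4 : q / L * ‖Φ t x - Φ t z‖ ≤ q * ‖x - z‖ := by
      calc q / L * ‖Φ t x - Φ t z‖ ≤ q / L * (‖x - z‖ * L) :=
            mul_le_mul_of_nonneg_left (hdist t ht) hη.le
        _ = q * ‖x - z‖ := by field_simp
    rw [h2]
    linarith [norm_add_le (f (Φ t x) - f (Φ t z) - fderiv ℝ f (Φ t z) (Φ t x - Φ t z))
      (fderiv ℝ f (Φ t z) (Φ t x - Φ t z - M t (x - z)))]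

end Flow

/-! ### Determinants in the plane and Liouville's formula -/

theorem det_eq_of_plane (L : Plane →L[ℝ] Plane) :
    L.det = L (EuclideanSpace.single 0 1) 0 * L (EuclideanSpace.single 1 1) 1 -
      L (EuclideanSpace.single 1 1) 0 * L (EuclideanSpace.single 0 1) 1 := by
  rw [ContinuousLinearMap.det, ← LinearMap.det_toMatrix (EuclideanSpace.basisFun (Fin 2) ℝ).toBasis,
    Matrix.det_fin_two]
  simp [LinearMap.toMatrix_apply]

theorem apply_eq_of_plane (L : Plane →L[ℝ] Plane) (x : Plane) (i : Fin 2) :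
    L x i = x 0 * L (EuclideanSpace.single 0 1) i + x 1 * L (EuclideanSpace.single 1 1) i := by
  have h : x = x 0 • EuclideanSpace.single 0 (1 : ℝ) + x 1 • EuclideanSpace.single 1 (1 : ℝ) := by
    ext j; fin_cases j <;> simp
  conv_lhs => rw [h]
  simp

/-- **Liouville's formula** in the plane. -/
theorem det_eq_exp_integral_trace {A M : ℝ → Plane →L[ℝ] Plane} (hA : Continuous A) {τ : ℝ}
    (hτ : 0 ≤ τ) (hM0 : M 0 = ContinuousLinearMap.id ℝ Plane)
    (hM : ∀ t ∈ Icc 0 τ, HasDerivWithinAt M ((A t).comp (M t)) (Icc 0 τ) t) :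
    (M τ).det =
      Real.exp (∫ t in (0 : ℝ)..τ, ∑ i : Fin 2, A t (EuclideanSpace.single i 1) i) := by
  set tr : ℝ → ℝ := fun t => ∑ i : Fin 2, A t (EuclideanSpace.single i 1) i with htr
  have hcont : Continuous tr := by
    refine continuous_finsetSum _ fun i _ => ?_
    exact (EuclideanSpace.proj (𝕜 := ℝ) i).continuous.comp (hA.clm_apply continuous_const)
  have hentry : ∀ i j : Fin 2, ∀ t ∈ Icc 0 τ, HasDerivWithinAt
      (fun t => M t (EuclideanSpace.single j 1) i)
      (A t (M t (EuclideanSpace.single j 1)) i) (Icc 0 τ) t := by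
    intro i j t ht
    have h1 := (hM t ht).clm_apply
      (hasDerivWithinAt_const t (Icc 0 τ) (EuclideanSpace.single j (1 : ℝ)))
    have h2 := ((EuclideanSpace.proj (𝕜 := ℝ) i : Plane →L[ℝ] ℝ).hasFDerivAt).comp_hasDerivWithinAt
      t h1
    refine HasDerivWithinAt.congr_deriv (f := fun t => M t (EuclideanSpace.single j 1) i) h2 ?_
    simp
  have hdet : ∀ t ∈ Icc 0 τ,
      HasDerivWithinAt (fun t => (M t).det) (tr t * (M t).det) (Icc 0 τ) t := by
    intro t ht
    simp only [det_eq_of_plane]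
    refine (((hentry 0 0 t ht).mul (hentry 1 1 t ht)).sub
      ((hentry 0 1 t ht).mul (hentry 1 0 t ht))).congr_deriv ?_
    simp only [htr, Fin.sum_univ_two, apply_eq_of_plane (A t) (M t _)]
    ring
  have hprod : ∀ t ∈ Icc 0 τ, HasDerivWithinAt
      (fun t => (M t).det * Real.exp (-∫ s in (0 : ℝ)..t, tr s)) 0 (Icc 0 τ) t := by
    intro t ht
    have hI : HasDerivAt (fun t => ∫ s in (0 : ℝ)..t, tr s) (tr t) t :=
      hcont.integral_hasStrictDerivAt 0 t |>.hasDerivAt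
    refine ((hdet t ht).mul hI.neg.exp.hasDerivWithinAt).congr_deriv ?_
    ring
  have hconst := constant_of_has_deriv_right_zero
    (fun t ht => (hprod t ht).continuousWithinAt)
    (fun t ht => (hprod t (Ico_subset_Icc_self ht)).mono_of_mem_nhdsWithin
      (Icc_mem_nhdsGE_of_mem ht)) τ (right_mem_Icc.2 hτ)
  simp only [hM0, intervalIntegral.integral_same, neg_zero, Real.exp_zero, mul_one] at hconst
  rw [Real.exp_neg, ← div_eq_mul_inv, div_eq_iff (Real.exp_ne_zero _)] at hconst
  rw [hconst]
  simp [ContinuousLinearMap.det]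

/-! ### Generators, heat kernel and conservation under diffusion -/

/-- If a family of maps preserves the integral for small positive times, then the values of its
generator have integral zero. -/
theorem mass_eq_zero_of_generatorMapsTo {S : ℝ → (Plane → ℝ) → Plane → ℝ} {φ f : L1}
    (hS : ∀ᶠ t in 𝓝[>] (0 : ℝ), Integrable (S t φ) ∧ ∫ x, S t φ x = ∫ x, φ x)
    (h : GeneratorMapsTo S φ f) : mass f = 0 := by
  have hφ : Integrable φ := L1.integrable_coeFn φ
  have hf : Integrable f := L1.integrable_coeFn f
  have hle : ∀ᶠ t in 𝓝[>] (0 : ℝ),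
      ‖mass f‖ₑ ≤ eLpNorm (fun x => t⁻¹ * (S t φ x - φ x) - f x) 1 volume := by
    filter_upwards [hS] with t ht
    have hint : ∫ x, (t⁻¹ * (S t φ x - φ x) - f x) = -mass f := by
      rw [integral_sub (f := fun x => t⁻¹ * (S t φ x - φ x)) ((ht.1.sub hφ).const_mul _) hf,
        integral_const_mul,
        integral_sub ht.1 hφ, ht.2]
      simp [mass]
    rw [← enorm_neg, ← hint, eLpNorm_one_eq_lintegral_enorm]
    exact enorm_integral_le_lintegral_enorm _
  have h0 : ‖mass f‖ₑ ≤ 0 := ge_of_tendsto h hle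
  simpa using h0

theorem integral_heatKernel {ε t : ℝ} (hε : 0 < ε) (ht : 0 < t) :
    ∫ x, heatKernel ε t x = 1 := by
  have hb : 0 < 1 / (4 * ε ^ 2 * t) := by positivity
  have h := GaussianFourier.integral_rexp_neg_mul_sq_norm (V := Plane) hb
  have h' : ∀ x : Plane, heatKernel ε t x = 1 / (4 * Real.pi * ε ^ 2 * t) *
      Real.exp (-(1 / (4 * ε ^ 2 * t)) * ‖x‖ ^ 2) := fun x => by
    rw [heatKernel]; congr 2; ring
  simp_rw [h']
  rw [integral_const_mul, h]
  simp only [finrank_euclideanSpace, Fintype.card_fin, Nat.cast_ofNat, div_self, ne_eq,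
    OfNat.ofNat_ne_zero, not_false_eq_true, Real.rpow_one]
  have := Real.pi_pos
  field_simp

/-- A non-integrable function has Bochner integral `0`, so a nonzero integral forces integrability.
-/
theorem integrable_heatKernel {ε t : ℝ} (hε : 0 < ε) (ht : 0 < t) :
    Integrable (heatKernel ε t) :=
  Integrable.of_integral_ne_zero (by rw [integral_heatKernel hε ht]; exact one_ne_zero)

/-- Transfers the normalization of the heat kernel to the source profile. -/
theorem gaussian_eq_heatKernel (σ : ℝ) (x : Plane) :
    gaussian σ x = heatKernel 1 (σ ^ 2 / 2) x := by
  rw [gaussian, heatKernel, EuclideanSpace.norm_sq_eq]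
  simp only [Fin.sum_univ_two, Real.norm_eq_abs, sq_abs]
  congr 2 <;> ring

theorem integrable_gaussian_sub {σ : ℝ} (hσ : 0 < σ) (y : Plane) :
    Integrable fun x => gaussian σ (x - y) := by
  simp_rw [gaussian_eq_heatKernel]
  exact (integrable_heatKernel one_pos (by positivity)).comp_sub_right y

theorem integral_gaussian_sub {σ : ℝ} (hσ : 0 < σ) (y : Plane) :
    ∫ x, gaussian σ (x - y) = 1 := by
  simp_rw [gaussian_eq_heatKernel]
  rw [integral_sub_right_eq_self (heatKernel 1 (σ ^ 2 / 2)) y]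
  exact integral_heatKernel one_pos (by positivity)

theorem integrable_and_integral_heatSemigroup {ε t : ℝ} (hε : 0 < ε) (ht : 0 < t)
    {φ : Plane → ℝ} (hφ : Integrable φ) :
    Integrable (heatSemigroup ε t φ) ∧ ∫ x, heatSemigroup ε t φ x = ∫ x, φ x := by
  have h : heatSemigroup ε t φ =
      convolution φ (heatKernel ε t) (ContinuousLinearMap.mul ℝ ℝ).flip volume := by
    ext x
    simp [heatSemigroup, ht.ne', convolution, mul_comm]
  have hK := integrable_heatKernel hε ht
  rw [h]
  refine ⟨hφ.integrable_convolution _ hK, ?_⟩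
  rw [integral_convolution _ hφ hK, integral_heatKernel hε ht]
  simp

theorem mass_eq_zero_of_diffusionMapsTo {ε : ℝ} (hε : 0 < ε) {φ f : L1}
    (h : DiffusionMapsTo ε φ f) : mass f = 0 := by
  refine mass_eq_zero_of_generatorMapsTo ?_ h
  filter_upwards [self_mem_nhdsWithin] with t ht
  exact integrable_and_integral_heatSemigroup hε ht (L1.integrable_coeFn φ)

/-! ### Conservation under convection -/

theorem fderiv_eq_sum_smulRight (C : Plane → Plane) (x : Plane) :
    fderiv ℝ C x = ∑ i : Fin 2,
      ContinuousLinearMap.smulRightL ℝ Plane Plane (EuclideanSpace.proj i) (partialDeriv C i x) := by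
  ext h j
  rw [apply_eq_of_plane]
  simp [partialDeriv, Fin.sum_univ_two]

theorem IsAdmissibleSpeed.uniformContinuous_fderiv {C : Plane → Plane}
    (hC : IsAdmissibleSpeed C) : UniformContinuous (fderiv ℝ C) := by
  rw [funext (fderiv_eq_sum_smulRight C)]
  simp only [Fin.sum_univ_two]
  exact ((ContinuousLinearMap.uniformContinuous _).comp (hC.partial_uniformContinuous 0)).add
    ((ContinuousLinearMap.uniformContinuous _).comp (hC.partial_uniformContinuous 1))

theorem IsAdmissibleSpeed.exists_norm_fderiv_le {C : Plane → Plane}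
    (hC : IsAdmissibleSpeed C) : ∃ K : NNReal, ∀ x, ‖fderiv ℝ C x‖ ≤ K := by
  obtain ⟨M, hM⟩ := hC.partial_bounded 0
  obtain ⟨N, hN⟩ := hC.partial_bounded 1
  set L : Fin 2 → Plane →L[ℝ] Plane →L[ℝ] Plane := fun i =>
    ContinuousLinearMap.smulRightL ℝ Plane Plane (EuclideanSpace.proj i) with hL
  refine ⟨(‖L 0‖ * M + ‖L 1‖ * N).toNNReal, fun x => le_trans ?_ (Real.le_coe_toNNReal _)⟩
  rw [fderiv_eq_sum_smulRight, Fin.sum_univ_two]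
  exact (norm_add_le _ _).trans (add_le_add ((L 0).le_opNorm_of_le (hM x))
    ((L 1).le_opNorm_of_le (hN x)))

/-- The flow of an admissible speed at small negative times is differentiable, and its Jacobian
is the weight of the convection semigroup. -/
theorem exists_hasFDerivAt_flow_neg {C : Plane → Plane} {flow : ℝ → Plane → Plane}
    (hC : IsAdmissibleSpeed C) (hflow : IsFlow C flow) :
    ∃ τ₀ > 0, ∀ τ, 0 < τ → τ ≤ τ₀ → Function.Bijective (flow (-τ)) ∧
      ∀ z, ∃ M : Plane →L[ℝ] Plane, HasFDerivAt (flow (-τ)) M z ∧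
        M.det = Real.exp (-∫ s in (0 : ℝ)..τ, divergence C (flow (-s) z)) := by
  have hdiff : Differentiable ℝ C := hC.contDiff.differentiable one_ne_zero
  have hUC := hC.uniformContinuous_fderiv
  obtain ⟨K, hK⟩ := hC.exists_norm_fderiv_le
  -- The backward flow of `C` is the forward flow of `-C`, to which the results for positive times
  -- apply.
  set f : Plane → Plane := fun x => -C x with hf
  have hfd : fderiv ℝ f = fun x => -fderiv ℝ C x := funext fun x => fderiv_fun_neg
  have hfK : ∀ x, ‖fderiv ℝ f x‖ ≤ K := fun x => by rw [hfd, norm_neg]; exact hK x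
  have hfUC : UniformContinuous (fderiv ℝ f) := by rw [hfd]; exact hUC.neg
  set Φ : ℝ → Plane → Plane := fun t => flow (-t) with hΦdef
  have h0 : ∀ z, Φ 0 z = z := fun z => by simp [hΦdef, hflow.1]
  have hΦ : ∀ t z, HasDerivAt (fun s => Φ s z) (f (Φ t z)) t := fun t z => by
    have := (hflow.2 (-t) z).scomp t (hasDerivAt_neg t)
    simpa [hf, hΦdef, Function.comp_def] using this
  have hlip : LipschitzWith K f :=
    lipschitzWith_of_nnnorm_fderiv_le hdiff.neg fun x => by exact_mod_cast hfK x
  -- `K + 1` keeps the denominator positive when `K = 0` and still gives `K * τ ≤ 1 / 2`.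
  refine ⟨1 / (2 * (K + 1)), by positivity, fun τ hτ hτ' => ⟨flow_bijective hlip h0 hΦ τ,
    fun z => ?_⟩⟩
  have hKτ : K * τ ≤ 1 / 2 := by
    rw [le_div_iff₀ (by positivity)] at hτ'
    nlinarith [K.2]
  have hcont : Continuous fun t => fderiv ℝ f (Φ t z) :=
    hfUC.continuous.comp (continuous_iff_continuousAt.2 fun t => (hΦ t z).continuousAt)
  obtain ⟨M, hM0, hM⟩ := exists_fundamentalSolution hcont (fun t => hfK _) hτ.le hKτ
  refine ⟨M τ, hasFDerivAt_flow hdiff.neg hfK hfUC h0 hΦ z hτ.le hM0 hM, ?_⟩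
  rw [det_eq_exp_integral_trace hcont hτ.le hM0 hM, ← intervalIntegral.integral_neg]
  simp [hfd, hΦdef, divergence, partialDeriv, add_comm]

theorem eventually_integrable_and_integral_convectionSemigroup {C : Plane → Plane}
    {flow : ℝ → Plane → Plane} (hC : IsAdmissibleSpeed C) (hflow : IsFlow C flow)
    {φ : Plane → ℝ} (hφ : Integrable φ) :
    ∀ᶠ t in 𝓝[>] (0 : ℝ), Integrable (convectionSemigroup C flow t φ) ∧
      ∫ x, convectionSemigroup C flow t φ x = ∫ x, φ x := by
  obtain ⟨τ, hτ, h⟩ := exists_hasFDerivAt_flow_neg hC hflow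
  filter_upwards [Ioc_mem_nhdsGT hτ] with t ht
  obtain ⟨hbij, hM⟩ := h t ht.1 ht.2
  choose M hM hdet using hM
  have heq : convectionSemigroup C flow t φ = fun x => |(M x).det| • φ (flow (-t) x) := by
    ext x
    rw [hdet, abs_of_pos (Real.exp_pos _), convectionSemigroup, smul_eq_mul]
  have himage : flow (-t) '' univ = univ := by rw [image_univ, hbij.2.range_eq]
  have hMw : ∀ x ∈ univ, HasFDerivWithinAt (flow (-t)) (M x) univ x :=
    fun x _ => (hM x).hasFDerivWithinAt
  have h1 := integrableOn_image_iff_integrableOn_abs_det_fderiv_smul volume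
    MeasurableSet.univ hMw hbij.1.injOn φ
  have h2 := integral_image_eq_integral_abs_det_fderiv_smul volume
    MeasurableSet.univ hMw hbij.1.injOn φ
  rw [himage] at h1 h2
  rw [integrableOn_univ, integrableOn_univ] at h1
  rw [Measure.restrict_univ] at h2
  rw [heq]
  exact ⟨h1.1 hφ, h2.symm⟩

theorem mass_eq_zero_of_convectionMapsTo {C : Plane → Plane} (hC : IsAdmissibleSpeed C)
    {φ f : L1} (h : ConvectionMapsTo C φ f) : mass f = 0 := by
  obtain ⟨flow, hflow, h⟩ := h
  exact mass_eq_zero_of_generatorMapsTo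
    (eventually_integrable_and_integral_convectionSemigroup hC hflow (L1.integrable_coeFn φ)) h

/-! ### Integrated equations for the masses -/

/-- The total mass as a continuous linear functional. -/
noncomputable def massCLM : L1 →L[ℝ] ℝ := L1.integralCLM

theorem massCLM_apply (φ : L1) : massCLM φ = mass φ := by
  rw [mass, ← L1.integral_eq_integral, L1.integral_eq]
  rfl

theorem intervalIntegrable_of_continuousOn_Ici {E : Type*} [NormedAddCommGroup E] {f : ℝ → E} (hf : ContinuousOn f (Ici 0)) {t : ℝ}
    (ht : 0 ≤ t) : IntervalIntegrable f volume 0 t :=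
  (hf.mono (by rw [uIcc_of_le ht]; exact Icc_subset_Ici_self)).intervalIntegrable

theorem hasDerivWithinAt_integral_of_continuousOn_Ici {E : Type*} [NormedAddCommGroup E]
    [NormedSpace ℝ E] [CompleteSpace E] {f : ℝ → E}
    (hf : ContinuousOn f (Ici 0)) {t : ℝ} (ht : 0 ≤ t) :
    HasDerivWithinAt (fun t => ∫ s in (0 : ℝ)..t, f s) (f t) (Ici 0) t := by
  -- Extending `f` by the constant `f 0` to negative times makes the two-sided fundamental theorem
  -- available at `0`.
  have hcont : Continuous fun s => f (max s 0) :=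
    hf.comp_continuous (by fun_prop) fun s => le_max_right s 0
  have h := (hcont.integral_hasStrictDerivAt 0 t).hasDerivAt.hasDerivWithinAt (s := Ici 0)
  rw [max_eq_left ht] at h
  have hcongr : ∀ r ∈ Ici (0 : ℝ), (∫ s in (0 : ℝ)..r, f s) = ∫ s in (0 : ℝ)..r, f (max s 0) := by
    intro r hr
    refine intervalIntegral.integral_congr fun s hs => ?_
    rw [uIcc_of_le hr] at hs
    simp only [max_eq_left hs.1]
  exact h.congr hcongr (hcongr t ht)

theorem mass_intervalIntegral {v : ℝ → L1} (hv : ContinuousOn v (Ici 0)) {t : ℝ} (ht : 0 ≤ t) :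
    mass (∫ s in (0 : ℝ)..t, v s) = ∫ s in (0 : ℝ)..t, mass (v s) := by
  simp_rw [← massCLM_apply]
  exact (massCLM.intervalIntegral_comp_comm (intervalIntegrable_of_continuousOn_Ici hv ht)).symm

theorem continuousOn_mass {v : ℝ → L1} (hv : ContinuousOn v (Ici 0)) :
    ContinuousOn (fun t => mass (v t)) (Ici 0) := by
  simp_rw [← massCLM_apply]
  exact massCLM.continuous.comp_continuousOn hv

namespace IsMildSolution

variable {ε σ α γ χ : ℝ} {C : Plane → Plane} {y : Plane} {u₀ : ℝ} {v₀ w₀ : L1} {u : ℝ → ℝ}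
  {v w : ℝ → L1}

theorem u_eq (h : IsMildSolution ε σ α γ χ C y u₀ v₀ w₀ u v w) {t : ℝ} (ht : 0 ≤ t) :
    u t = u₀ + χ * (∫ s in (0 : ℝ)..t, mass (w s)) - γ * ∫ s in (0 : ℝ)..t, u s := by
  rw [← mass_intervalIntegral h.continuous_w ht]
  exact h.home t ht

theorem mass_w_eq (h : IsMildSolution ε σ α γ χ C y u₀ v₀ w₀ u v w) {t : ℝ} (ht : 0 ≤ t) :
    mass (w t) = mass w₀ + α * (∫ s in (0 : ℝ)..t, mass (v s)) -
      χ * ∫ s in (0 : ℝ)..t, mass (w s) := by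
  rw [← mass_intervalIntegral h.continuous_v ht, ← mass_intervalIntegral h.continuous_w ht,
    h.work t ht]
  simp_rw [← massCLM_apply]
  simp

theorem mass_v_eq (hε : 0 < ε) (hσ : 0 < σ) (hC : IsAdmissibleSpeed C)
    (h : IsMildSolution ε σ α γ χ C y u₀ v₀ w₀ u v w) {t : ℝ} (ht : 0 ≤ t) :
    mass (v t) = mass v₀ - α * (∫ s in (0 : ℝ)..t, mass (v s)) + γ * ∫ s in (0 : ℝ)..t, u s := by
  obtain ⟨a, b, ha, hb, hab⟩ := h.travel t ht
  have ha0 : ∫ x, a x = 0 := mass_eq_zero_of_diffusionMapsTo hε ha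
  have hb0 : ∫ x, b x = 0 := mass_eq_zero_of_convectionMapsTo hC hb
  rw [← mass_intervalIntegral h.continuous_v ht]
  generalize (∫ s in (0 : ℝ)..t, v s : L1) = φ at hab ⊢
  generalize (∫ s in (0 : ℝ)..t, u s) = U at hab ⊢
  have hab_int : Integrable fun x => a x + b x :=
    (L1.integrable_coeFn a).add (L1.integrable_coeFn b)
  have hφ : Integrable fun x => α * φ x := (L1.integrable_coeFn φ).const_mul α
  have hg : Integrable fun x => γ * gaussian σ (x - y) * U :=
    ((integrable_gaussian_sub hσ y).const_mul γ).mul_const U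
  have h1 : Integrable fun x => v₀ x + (a x + b x) := (L1.integrable_coeFn v₀).add hab_int
  have h2 : Integrable fun x => v₀ x + (a x + b x) - α * φ x := h1.sub hφ
  rw [mass, integral_congr_ae hab, integral_add h2 hg, integral_sub h1 hφ,
    integral_add (L1.integrable_coeFn v₀) hab_int,
    integral_add (L1.integrable_coeFn a) (L1.integrable_coeFn b), ha0, hb0, integral_const_mul,
    integral_mul_const, integral_const_mul, integral_gaussian_sub hσ]
  simp [mass]

end IsMildSolution

end ReturnHome

theorem theorem4p3 (ε σ α γ χ : ℝ) (hε : 0 < ε) (hσ : 0 < σ)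
    (C : ReturnHome.Plane → ReturnHome.Plane) (hC : ReturnHome.IsAdmissibleSpeed C)
    (y : ReturnHome.Plane) (u₀ : ℝ) (v₀ w₀ : ReturnHome.L1)
    (u : ℝ → ℝ) (v w : ℝ → ReturnHome.L1)
    (hsol : ReturnHome.IsMildSolution ε σ α γ χ C y u₀ v₀ w₀ u v w)
    (V W : ℝ → ℝ) (hV : ∀ t, V t = ∫ x, v t x) (hW : ∀ t, W t = ∫ x, w t x) :
    (∀ t, 0 ≤ t →
      HasDerivWithinAt u (χ * W t - γ * u t) (Set.Ici 0) t ∧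
      HasDerivWithinAt V (-α * V t + γ * u t) (Set.Ici 0) t ∧
      HasDerivWithinAt W (α * V t - χ * W t) (Set.Ici 0) t) ∧
    (u 0 = u₀ ∧ V 0 = ∫ x, v₀ x ∧ W 0 = ∫ x, w₀ x) ∧
    (∀ t, 0 ≤ t →
      u t + (∫ x, v t x) + (∫ x, w t x) = u₀ + (∫ x, v₀ x) + (∫ x, w₀ x)) := by
  obtain rfl : V = fun t => ReturnHome.mass (v t) := funext hV
  obtain rfl : W = fun t => ReturnHome.mass (w t) := funext hW
  have hu : ∀ t ∈ Ici (0 : ℝ), _ := fun t ht => hsol.u_eq ht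
  have hv : ∀ t ∈ Ici (0 : ℝ), _ := fun t ht => hsol.mass_v_eq hε hσ hC ht
  have hw : ∀ t ∈ Ici (0 : ℝ), _ := fun t ht => hsol.mass_w_eq ht
  refine ⟨fun t ht => ?_, ⟨?_, ?_, ?_⟩, fun t ht => ?_⟩
  · have hU := ReturnHome.hasDerivWithinAt_integral_of_continuousOn_Ici hsol.continuous_u ht
    have hV := ReturnHome.hasDerivWithinAt_integral_of_continuousOn_Ici
      (ReturnHome.continuousOn_mass hsol.continuous_v) ht
    have hW := ReturnHome.hasDerivWithinAt_integral_of_continuousOn_Ici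
      (ReturnHome.continuousOn_mass hsol.continuous_w) ht
    refine ⟨?_, ?_, ?_⟩
    · exact (((hW.const_mul χ).const_add u₀).sub (hU.const_mul γ)).congr hu (hu t ht)
    · refine ((((hV.const_mul α).const_sub (ReturnHome.mass v₀)).add
        (hU.const_mul γ)).congr hv (hv t ht)).congr_deriv ?_
      ring
    · exact (((hV.const_mul α).const_add (ReturnHome.mass w₀)).sub
        (hW.const_mul χ)).congr hw (hw t ht)
  · simpa using hu 0 self_mem_Ici
  · simpa [ReturnHome.mass] using hv 0 self_mem_Ici
  · simpa [ReturnHome.mass] using hw 0 self_mem_Ici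
  · change u t + ReturnHome.mass (v t) + ReturnHome.mass (w t) =
      u₀ + ReturnHome.mass v₀ + ReturnHome.mass w₀
    linarith [hu t ht, hv t ht, hw t ht]
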